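/- Let $L$ be an integral lattice, that is, a free abelian group of finite rank with a nondegenerate symmetric bilinear form $Q : L\times L\to\mathbb{Z}$, not assumed definite. Write $x\cdot y$ for $Q(x,y)$ and for its real bilinear extension to $V=\mathbb{R}\otimes L$, and $x^2$ for $x\cdot x$. Let $\sigma(L)$ be the signature of $Q$, and let $\delta\in\mathbb{N}$ be the absolute value of the determinant of $L$ (the determinant of the Gram matrix of $Q$ in a basis of $L$); so $\delta$ is the determinant itself when that is positive. A characteristic covector for $L$ is a vector $\xi\in V$ such that $\xi\cdot y\in\mathbb{Z}$ and $\xi\cdot y\equiv y^2 \pmod 2$ for all $y\in L$. Then for every characteristic covector $\xi$ for $L$, $$\xi^2\equiv \begin{cases}\sigma(L)-1+1/\delta & \text{if } \delta \text{ is odd},\\ \sigma(L)-1 & \text{if } \delta\text{ is even}\end{cases}\pmod{\tfrac4\delta},$$ where, for real numbers $a,b$, $a\equiv b \pmod{4/\delta}$ means that $a-b$ is an integer multiple of $4/\delta$. -/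

import Mathlib

open scoped TensorProduct

noncomputable section

namespace IntLattice

/-! An integral lattice is a free abelian group `L` of finite rank with a nondegenerate symmetric
bilinear form `Q` with values in `ℤ`. -/

variable {L : Type*} [AddCommGroup L]

/-- The extension of the form `Q` to the real vector space `V = ℝ ⊗ L`. -/
def realForm (Q : LinearMap.BilinForm ℤ L) : LinearMap.BilinForm ℝ (ℝ ⊗[ℤ] L) :=
  Q.baseChange ℝ

/-- The inclusion of `L` in `V = ℝ ⊗ L`. -/
def toReal : L →ₗ[ℤ] ℝ ⊗[ℤ] L :=
  TensorProduct.mk ℤ ℝ L 1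

/-- The dual lattice `L'`: the vectors `x` of `V` such that `x · y` is an integer for all `y ∈ L`. -/
def dualLattice (Q : LinearMap.BilinForm ℤ L) : Submodule ℤ (ℝ ⊗[ℤ] L) :=
  (realForm Q).dualSubmodule (LinearMap.range toReal)

theorem realForm_tmul (Q : LinearMap.BilinForm ℤ L) (a b : ℝ) (x y : L) :
    realForm Q (a ⊗ₜ x) (b ⊗ₜ y) = a * b * Q x y := by
  simp [realForm, LinearMap.BilinForm.baseChange_tmul, mul_comm]

theorem toReal_apply (x : L) : toReal x = (1 : ℝ) ⊗ₜ[ℤ] x := rfl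

theorem mem_dualLattice (Q : LinearMap.BilinForm ℤ L) (x : ℝ ⊗[ℤ] L) :
    x ∈ dualLattice Q ↔ ∀ y : L, ∃ n : ℤ, (n : ℝ) = realForm Q x (toReal y) := by
  simp [dualLattice, LinearMap.BilinForm.mem_dualSubmodule, Submodule.mem_one]

/-- A characteristic covector: an element `ξ` of the dual lattice with `ξ · y ≡ y · y` modulo `2`
for all `y ∈ L`. -/
def IsCharacteristicCovector (Q : LinearMap.BilinForm ℤ L) (ξ : ℝ ⊗[ℤ] L) : Prop :=
  ξ ∈ dualLattice Q ∧
    ∀ y : L, realForm Q ξ (toReal y) ≡ (Q y y : ℝ) [PMOD (2 : ℝ)]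

/-- The signature of `Q`: the maximal dimension of a positive definite subspace of `V` minus the
maximal dimension of a negative definite one. -/
def signature (Q : LinearMap.BilinForm ℤ L) : ℤ :=
  (sigPos (realForm Q).toQuadraticMap : ℤ) - (sigNeg (realForm Q).toQuadraticMap : ℤ)

open scoped Classical in
/-- The determinant of the lattice: the determinant of the Gram matrix of `Q` in a basis of `L`. -/
def latticeDet [Module.Free ℤ L] [Module.Finite ℤ L] (Q : LinearMap.BilinForm ℤ L) : ℤ :=
  (LinearMap.BilinForm.toMatrix (Module.Free.chooseBasis ℤ L) Q).det

/-- The determinant does not depend on the basis. -/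
theorem latticeDet_eq [Module.Free ℤ L] [Module.Finite ℤ L] (Q : LinearMap.BilinForm ℤ L)
    {ι : Type*} [Fintype ι] [DecidableEq ι] (b : Module.Basis ι ℤ L) :
    latticeDet Q = (LinearMap.BilinForm.toMatrix b Q).det := by
  classical
  set c := Module.Free.chooseBasis ℤ L with hc
  let e := c.indexEquiv b
  have h1 : LinearMap.BilinForm.toMatrix (c.reindex e) Q =
      (LinearMap.BilinForm.toMatrix c Q).submatrix e.symm e.symm := by
    ext i j
    simp [LinearMap.BilinForm.toMatrix_apply]
  have h2 := LinearMap.BilinForm.toMatrix_mul_basis_toMatrix (c.reindex e) b Q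
  have h3 : ((c.reindex e).toMatrix b).det * ((c.reindex e).toMatrix b).det = 1 := by
    have hu : IsUnit ((c.reindex e).toMatrix b).det := by
      rw [← Module.Basis.det_apply]
      exact (c.reindex e).isUnit_det b
    exact Int.isUnit_mul_self hu
  have h4 : latticeDet Q = (LinearMap.BilinForm.toMatrix (c.reindex e) Q).det := by
    rw [h1, Matrix.det_submatrix_equiv_self]
    simp only [latticeDet, hc]
  rw [h4, ← h2, Matrix.det_mul, Matrix.det_mul, Matrix.det_transpose]
  linear_combination (-(LinearMap.BilinForm.toMatrix (c.reindex e) Q).det) * h3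

end IntLattice

end

/-! Let `G` be the Gram matrix, `D` its determinant, `v` the values of `ξ` on the basis and `c` its
coordinates, so that `G c = v` and `ξ² = v ⬝ c`. The rank-one updates `G ± v vᵀ` have determinants
`D (1 ± ξ²)`; since `v` agrees modulo 2 with the diagonal of `G`, both have even diagonal. A
symmetric matrix of order `2m` with even diagonal has determinant 0 or `(-1)^m` modulo 4
(`Matrix.det_zmod_four_of_even_diag`). The two determinants sum to `2D`, so the parity of `D`
selects the value, and `D ξ²` is known modulo 4 (`Matrix.exists_intCast_eq_det_mul`). Over `ℝ`, with
`k` negative squares, `σ = n - 2k` and `δ = (-1)^k D`. This turns the formula in `D` and `n` into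
one in `δ` and `σ`; dividing by `δ` gives the modulus `4/δ`. -/

/-! ### Determinants over `ℤ/4` and rank-one updates -/

open Matrix in
/-- A symmetric matrix of even order over `ℤ/4` with even diagonal has determinant `0` or
`(-1) ^ m`, where `2 * m` is its order. -/
theorem Matrix.det_zmod_four_of_even_diag (m : ℕ) :
    ∀ {ι : Type*} [Fintype ι] [DecidableEq ι] (G : Matrix ι ι (ZMod 4)),
      Fintype.card ι = 2 * m → G.IsSymm → (∀ i, 2 * G i i = 0) → G.det = 0 ∨ G.det = (-1) ^ m := by
  induction m with
  | zero =>
    intro ι _ _ G hc _ _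
    have : IsEmpty ι := Fintype.card_eq_zero_iff.mp (by simpa using hc)
    right; simp
  | succ m ih =>
    intro ι _ _ G hc hs hd
    by_cases hall : ∀ i j, 2 * G i j = 0
    -- All entries are even and the order is at least 2, so `4` divides the determinant.
    · left
      have key : ∀ a : ZMod 4, 2 * a = 0 → ∃ b, a = 2 * b := by decide
      choose H hH using fun i j => key _ (hall i j)
      have hG : G = (2 : ZMod 4) • Matrix.of H := by ext i j; simp [hH i j]
      rw [hG, det_smul, hc, show 2 * (m + 1) = 2 * m + 2 by ring, pow_add,
        show (2 : ZMod 4) ^ 2 = 0 by decide, mul_zero, zero_mul]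
    -- An odd entry lies off the diagonal. The block `[p, b; b, q]` through it has determinant `-1`,
    -- and passing to its Schur complement lowers the order by 2.
    · push Not at hall
      obtain ⟨i, j, hij⟩ := hall
      have hne : i ≠ j := fun h => hij (h ▸ hd i)
      have hinj : Function.Injective ![i, j] := by
        intro a b hab
        fin_cases a <;> fin_cases b <;> simp_all
      classical
      let e : Fin 2 ⊕ ↥(Set.range ![i, j])ᶜ ≃ ι :=
        ((Equiv.ofInjective _ hinj).sumCongr (Equiv.refl _)).trans
          (Equiv.Set.sumCompl (Set.range ![i, j]))
      have he : ∀ k, e (Sum.inl k) = ![i, j] k := fun k => rfl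
      set M := G.submatrix e e with hM
      have hMs : M.IsSymm := hs.submatrix e
      have hMd : ∀ k, 2 * M k k = 0 := fun k => hd (e k)
      rw [← det_submatrix_equiv_self e G, ← hM]
      set p := G i i with hp
      set q := G j j with hq
      set b := G i j with hb
      have hji : G j i = b := hs.apply i j
      have hA : M.toBlocks₁₁ = !![p, b; b, q] := by
        ext k l
        fin_cases k <;> fin_cases l <;> simp [toBlocks₁₁, hM, he, hp, hq, hb, hji]
      have hpq : p * q = 0 ∧ b * b = 1 := by
        have : ∀ p q b : ZMod 4, 2 * p = 0 → 2 * q = 0 → 2 * b ≠ 0 → p * q = 0 ∧ b * b = 1 := by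
          decide
        exact this p q b (hd i) (hd j) hij
      let N : Matrix (Fin 2) (Fin 2) (ZMod 4) := !![-q, b; b, -p]
      have hinv : N * M.toBlocks₁₁ = 1 := by
        rw [hA]
        ext k l
        fin_cases k <;> fin_cases l <;> simp [N, mul_apply, Fin.sum_univ_two, hpq] <;>
          grind
      let _ : Invertible M.toBlocks₁₁ := invertibleOfLeftInverse _ N hinv
      have hN : ⅟M.toBlocks₁₁ = N := rfl
      have hdet : M.toBlocks₁₁.det = -1 := by
        rw [hA, det_fin_two_of, hpq.1, hpq.2]; ring
      have h12 : ∀ k l, M.toBlocks₂₁ k l = M.toBlocks₁₂ l k := fun k l => hMs.apply _ _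
      rw [← fromBlocks_toBlocks M, det_fromBlocks₁₁, hN, hdet]
      have hcard : Fintype.card ↥(Set.range ![i, j])ᶜ = 2 * m := by
        have := Fintype.card_congr e
        rw [Fintype.card_sum, Fintype.card_fin] at this
        omega
      have hNs : N.IsSymm := by
        ext k l
        fin_cases k <;> fin_cases l <;> simp [N]
      have h21 : M.toBlocks₂₁ = M.toBlocks₁₂ᵀ := by ext k l; exact h12 k l
      have h22 : M.toBlocks₂₂.IsSymm := by ext k l; exact hMs.apply _ _
      rcases ih (M.toBlocks₂₂ - M.toBlocks₂₁ * N * M.toBlocks₁₂) hcard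
        (by
          rw [IsSymm, transpose_sub, h22.eq, h21, transpose_mul, transpose_mul, hNs.eq,
            transpose_transpose, Matrix.mul_assoc])
        (by
          intro k
          have h1 : 2 * M.toBlocks₂₂ k k = 0 := hMd (Sum.inr k)
          have h2 : 2 * p = 0 := hd i
          have h3 : 2 * q = 0 := hd j
          have h4 : (4 : ZMod 4) = 0 := by decide
          simp only [sub_apply, mul_apply, Fin.sum_univ_two, h12, N, of_apply, cons_val', cons_val_zero,
            cons_val_one, cons_val_fin_one]
          -- The Schur complement keeps an even diagonal: the squares carry the even factors `p`,
          -- `q`, and the cross term occurs twice.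
          linear_combination h1 + M.toBlocks₁₂ 0 k ^ 2 * h3 + M.toBlocks₁₂ 1 k ^ 2 * h2
            - b * M.toBlocks₁₂ 0 k * M.toBlocks₁₂ 1 k * h4) with h | h
      · left; rw [h, mul_zero]
      · right; rw [h, pow_succ, mul_comm]

open Matrix in
theorem Matrix.det_add_vecMulVec_mulVec {ι R : Type*} [Fintype ι] [DecidableEq ι] [CommRing R]
    (G : Matrix ι ι R) (c w : ι → R) :
    (G + vecMulVec (G *ᵥ c) w).det = G.det * (1 + w ⬝ᵥ c) := by
  have h : G + vecMulVec (G *ᵥ c) w = G * (1 + replicateCol Unit c * replicateRow Unit w) := by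
    rw [Matrix.mul_add, Matrix.mul_one, ← vecMulVec_eq, mul_vecMulVec]
  rw [h, det_mul, det_one_add_replicateCol_mul_replicateRow]

/-! ### Signature and sign of the determinant -/

open QuadraticMap in
/-- The number of negative squares of a real symmetric form is read off from the sign of its
determinant, up to parity. -/
theorem LinearMap.BilinForm.sigPos_add_sigNeg_and_sign_det {V : Type*} {ι : Type*} [AddCommGroup V]
    [Module ℝ V] [Fintype ι] [DecidableEq ι] (b : Module.Basis ι ℝ V) (B : LinearMap.BilinForm ℝ V)
    (hB : B.IsSymm) (hdet : (LinearMap.BilinForm.toMatrix b B).det ≠ 0) :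
    sigPos B.toQuadraticMap + sigNeg B.toQuadraticMap = Fintype.card ι ∧
      0 < (-1) ^ sigNeg B.toQuadraticMap * (LinearMap.BilinForm.toMatrix b B).det := by
  have : FiniteDimensional ℝ V := b.finiteDimensional_of_finite
  obtain ⟨c₀, hc₀⟩ := LinearMap.BilinForm.exists_orthogonal_basis (B := B) ⟨hB.eq⟩
  have hfin : Module.finrank ℝ V = Fintype.card ι := Module.finrank_eq_card_basis b
  let c : Module.Basis ι ℝ V := c₀.reindex (Fintype.equivOfCardEq (by simp [hfin]))
  have hc : ∀ i j, i ≠ j → B (c i) (c j) = 0 := by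
    intro i j hij
    simp only [c, Module.Basis.reindex_apply]
    exact hc₀ (by simpa using hij)
  set w : ι → ℝ := fun i => B (c i) (c i) with hw
  have hdiag : LinearMap.BilinForm.toMatrix c B = Matrix.diagonal w := by
    ext i j
    rw [LinearMap.BilinForm.toMatrix_apply, Matrix.diagonal_apply]
    split_ifs with h
    · subst h; rfl
    · exact hc i j h
  -- A change of basis multiplies the determinant by a square, so its sign is that of the diagonal
  -- form.
  have hprod : (LinearMap.BilinForm.toMatrix b B).det = (c.toMatrix b).det ^ 2 * ∏ i, w i := by
    rw [← LinearMap.BilinForm.toMatrix_mul_basis_toMatrix c b B, hdiag, Matrix.det_mul,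
      Matrix.det_mul, Matrix.det_transpose, Matrix.det_diagonal]
    ring
  have hP : ∏ i, w i ≠ 0 := fun h => hdet (by rw [hprod, h, mul_zero])
  have hC : (c.toMatrix b).det ≠ 0 := fun h => hdet (by rw [hprod, h]; ring)
  have hw0 : ∀ i, w i ≠ 0 := fun i => Finset.prod_ne_zero_iff.mp hP i (Finset.mem_univ i)
  have hrepr : B.toQuadraticMap.basisRepr c = weightedSumSquares ℝ w := by
    ext x
    simp only [basisRepr_apply, LinearMap.BilinMap.toQuadraticMap_apply, map_sum,
      LinearMap.sum_apply, map_smul, LinearMap.smul_apply, smul_eq_mul, weightedSumSquares_apply]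
    refine Finset.sum_congr rfl fun i _ => ?_
    rw [Finset.sum_eq_single i (fun j _ hj => by rw [hc j i hj]; ring) (by simp)]
    simp only [hw]
    ring
  have hequiv : QuadraticMap.Equivalent B.toQuadraticMap (weightedSumSquares ℝ w) :=
    hrepr ▸ ⟨isometryEquivBasisRepr B.toQuadraticMap c⟩
  rw [QuadraticForm.sigNeg_of_equiv_weightedSumSquares hequiv,
    QuadraticForm.sigPos_of_equiv_weightedSumSquares hequiv]
  constructor
  · have hcompl : {i | w i < 0} = {i | 0 < w i}ᶜ := by
      ext i
      simp [(hw0 i).le_iff_lt]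
    rw [hcompl, Set.ncard_add_ncard_compl, Nat.card_eq_fintype_card]
  · rw [hprod, mul_left_comm]
    refine mul_pos (by positivity) ?_
    classical
    have hcard : (-1 : ℝ) ^ {i | w i < 0}.ncard = ∏ i, if w i < 0 then -1 else 1 := by
      rw [Finset.prod_ite, Finset.prod_const, Finset.prod_const_one, mul_one,
        Set.ncard_eq_toFinset_card', Set.toFinset_ofPred]
    rw [hcard, ← Finset.prod_mul_distrib]
    refine Finset.prod_pos fun i _ => ?_
    split_ifs with h
    · linarith
    · rw [one_mul]
      exact lt_of_le_of_ne (not_lt.mp h) (hw0 i).symm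

/-! ### The integer `det G * (v ⬝ c)` modulo 4 -/

open Matrix in
theorem Matrix.exists_intCast_eq_det_mul_of_even_card {ι : Type*} [Fintype ι] [DecidableEq ι]
    (hn : Even (Fintype.card ι)) (G : Matrix ι ι ℤ) (hG : G.IsSymm) (v : ι → ℤ)
    (hv : ∀ i, v i ≡ G i i [ZMOD 2]) (c : ι → ℝ)
    (hc : G.map (Int.cast : ℤ → ℝ) *ᵥ c = fun i => (v i : ℝ)) :
    ∃ x : ℤ, (x : ℝ) = G.det * ((fun i => (v i : ℝ)) ⬝ᵥ c) ∧
      (x : ZMod 4) = G.det * (Fintype.card ι - 1) + (G.det : ZMod 4) ^ 2 := by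
  obtain ⟨m, hm⟩ := hn.exists_two_nsmul
  rw [smul_eq_mul] at hm
  set vR : ι → ℝ := fun i => (v i : ℝ) with hvR
  have hdetR : (G.map (Int.cast : ℤ → ℝ)).det = (G.det : ℝ) :=
    ((Int.castRingHom ℝ).map_det G).symm
  have hplus : (((G + vecMulVec v v).det : ℤ) : ℝ) = G.det * (1 + vR ⬝ᵥ c) := by
    rw [← hdetR, ← det_add_vecMulVec_mulVec, hc]
    refine ((Int.castRingHom ℝ).map_det _).trans (congrArg _ ?_)
    ext i j
    simp [vecMulVec_apply, hvR]
  have hminus : (((G + vecMulVec v (-v)).det : ℤ) : ℝ) = G.det * (1 - vR ⬝ᵥ c) := by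
    rw [sub_eq_add_neg, ← neg_dotProduct, ← hdetR, ← det_add_vecMulVec_mulVec, hc]
    refine ((Int.castRingHom ℝ).map_det _).trans (congrArg _ ?_)
    ext i j
    simp [vecMulVec_apply, hvR]
  -- Only `s = ±1` is used; `v i + s * v i ^ 3`-type parity is not needed, since `G i i + s * v i ^
  -- 2` is even as soon as `s` is odd.
  have heven : ∀ s : ℤ, s ^ 2 = 1 → ((G + vecMulVec v (s • v)).det : ZMod 4) = 0 ∨
      ((G + vecMulVec v (s • v)).det : ZMod 4) = (-1) ^ m := by
    intro s hs
    have hmap : ((G + vecMulVec v (s • v)).det : ZMod 4) =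
        ((G + vecMulVec v (s • v)).map (Int.cast : ℤ → ZMod 4)).det :=
      (Int.castRingHom (ZMod 4)).map_det _
    rw [hmap]
    refine det_zmod_four_of_even_diag m _ hm ?_ fun i => ?_
    · ext i j
      simp only [transpose_apply, map_apply, add_apply, vecMulVec_apply, Pi.smul_apply,
        smul_eq_mul, hG.apply i j]
      push_cast
      ring
    · have key : (4 : ℤ) ∣ 2 * (G i i + v i * (s * v i)) := by
        have h2 : (2 : ℤ) ∣ G i i + v i * (s * v i) := by
          have hs2 : Odd s := by
            rcases sq_eq_one_iff.mp hs with h | h <;> subst h <;> decide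
          have h3 : Even (G i i) ↔ Even (v i) := by
            rw [Int.even_iff, Int.even_iff, (hv i).eq]
          rw [← even_iff_two_dvd, Int.even_add, Int.even_mul, Int.even_mul, h3]
          simp [Int.not_even_iff_odd.mpr hs2]
        exact mul_dvd_mul_left 2 h2
      have := (ZMod.intCast_zmod_eq_zero_iff_dvd _ 4).mpr key
      push_cast at this
      simpa [vecMulVec_apply] using this
  refine ⟨(G + vecMulVec v v).det - G.det, by rw [Int.cast_sub, hplus]; ring, ?_⟩
  have hsum : (G + vecMulVec v (-v)).det + (G + vecMulVec v v).det = 2 * G.det := by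
    have : (((G + vecMulVec v (-v)).det + (G + vecMulVec v v).det : ℤ) : ℝ) =
        ((2 * G.det : ℤ) : ℝ) := by
      rw [Int.cast_add, hplus, hminus, Int.cast_mul, Int.cast_ofNat]
      ring
    exact_mod_cast this
  have hsum' := congrArg (Int.cast : ℤ → ZMod 4) hsum
  have h1 := heven 1 (by norm_num)
  have h2 := heven (-1) (by norm_num)
  rw [one_smul] at h1
  rw [neg_one_smul] at h2
  rw [Int.cast_add, Int.cast_mul, Int.cast_ofNat] at hsum'
  rw [Int.cast_sub, hm, Nat.cast_mul, Nat.cast_ofNat]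
  -- Now `e + f = 2D` with `e`, `f` in `{0, (-1)^m}`: both are `(-1)^m` if `D` is odd and both are 0
  -- if `D` is even. Only the parity of `m` matters, which leaves a finite check.
  generalize ((G + vecMulVec v v).det : ZMod 4) = e at *
  generalize ((G + vecMulVec v (-v)).det : ZMod 4) = f at *
  generalize (G.det : ZMod 4) = D at *
  have h4 : (4 : ZMod 4) = 0 := by decide
  obtain ⟨k, rfl | rfl⟩ := Nat.even_or_odd' m
  · have hk : (2 * ((2 * k : ℕ) : ZMod 4)) = 0 := by push_cast; linear_combination k * h4
    rw [hk]
    rw [pow_mul, neg_one_sq, one_pow] at h1 h2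
    revert e f D
    decide
  · have hk : (2 * ((2 * k + 1 : ℕ) : ZMod 4)) = 2 := by push_cast; linear_combination k * h4
    rw [hk]
    rw [pow_succ, pow_mul, neg_one_sq, one_pow, one_mul] at h1 h2
    revert e f D
    decide

open Matrix in
/-- If `v` is congruent modulo `2` to the diagonal of the symmetric integer matrix `G` and
`G c = v`, then `det G * (v ⬝ c)` is an integer which is determined modulo `4` by `det G` and the
order of `G`. -/
theorem Matrix.exists_intCast_eq_det_mul {ι : Type*} [Fintype ι] [DecidableEq ι]
    (G : Matrix ι ι ℤ) (hG : G.IsSymm) (v : ι → ℤ)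
    (hv : ∀ i, v i ≡ G i i [ZMOD 2]) (c : ι → ℝ)
    (hc : G.map (Int.cast : ℤ → ℝ) *ᵥ c = fun i => (v i : ℝ)) :
    ∃ x : ℤ, (x : ℝ) = G.det * ((fun i => (v i : ℝ)) ⬝ᵥ c) ∧
      (x : ZMod 4) = G.det * (Fintype.card ι - 1) + (G.det : ZMod 4) ^ 2 := by
  rcases Nat.even_or_odd (Fintype.card ι) with hn | hn
  · exact exists_intCast_eq_det_mul_of_even_card hn G hG v hv c hc
  -- Odd order is made even by adding an orthogonal summand `⟨1⟩` with coordinate 1 in `v` and `c`;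
  -- this keeps the determinant and adds 1 to `v ⬝ c`.
  · have hdet : (fromBlocks G 0 0 (1 : Matrix Unit Unit ℤ)).det = G.det := by simp
    obtain ⟨x, hx, hx4⟩ := exists_intCast_eq_det_mul_of_even_card (ι := ι ⊕ Unit)
      (by simpa [Nat.even_add_one] using hn) (fromBlocks G 0 0 1)
      (isSymm_fromBlocks_iff.mpr ⟨hG, by simp, by simp, isSymm_one⟩) (Sum.elim v 1)
      (by
        rintro (i | i)
        · simpa using hv i
        · simp) (Sum.elim c 1)
      (by
        rw [fromBlocks_map, fromBlocks_mulVec]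
        ext (i | i)
        · simpa using congrFun hc i
        · simp)
    rw [hdet] at hx hx4
    refine ⟨x - G.det, ?_, ?_⟩
    · rw [Int.cast_sub, hx]
      simp only [dotProduct, Fintype.sum_sum_type, Sum.elim_inl, Sum.elim_inr, Pi.one_apply,
        Int.cast_one, mul_one, Finset.univ_unique, Finset.sum_singleton]
      ring
    · rw [Int.cast_sub, hx4, Fintype.card_sum, Fintype.card_unit, Nat.cast_add, Nat.cast_one]
      ring

/-! ### Characteristic covectors and the main theorem -/

namespace IntLattice

variable {L : Type*} [AddCommGroup L]

theorem toMatrix_realForm {ι : Type*} [Fintype ι] [DecidableEq ι] (Q : LinearMap.BilinForm ℤ L)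
    (b : Module.Basis ι ℤ L) :
    LinearMap.BilinForm.toMatrix (b.baseChange ℝ) (realForm Q) =
      (LinearMap.BilinForm.toMatrix b Q).map (Int.cast : ℤ → ℝ) := by
  ext i j
  simp [LinearMap.BilinForm.toMatrix_apply, realForm_tmul]

/-- The square of a characteristic covector times the determinant, modulo `4`. -/
theorem IsCharacteristicCovector.exists_intCast_eq_det_mul {ι : Type*} [Fintype ι] [DecidableEq ι]
    {Q : LinearMap.BilinForm ℤ L} (hsymm : Q.IsSymm) (b : Module.Basis ι ℤ L) {ξ : ℝ ⊗[ℤ] L}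
    (hξ : IsCharacteristicCovector Q ξ) :
    ∃ x : ℤ, (x : ℝ) = (LinearMap.BilinForm.toMatrix b Q).det * realForm Q ξ ξ ∧
      (x : ZMod 4) = (LinearMap.BilinForm.toMatrix b Q).det * (Fintype.card ι - 1) +
        ((LinearMap.BilinForm.toMatrix b Q).det : ZMod 4) ^ 2 := by
  choose v hv using fun i => (mem_dualLattice Q ξ).mp hξ.1 (b i)
  set c : ι → ℝ := fun i => (b.baseChange ℝ).repr ξ i with hc
  have hsum : ξ = ∑ i, c i • toReal (b i) := by
    conv_lhs => rw [← (b.baseChange ℝ).sum_repr ξ]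
    simp [toReal_apply, hc]
  have hQξ : ∀ i, realForm Q ξ (toReal (b i)) = ∑ j, c j * Q (b j) (b i) := by
    intro i
    conv_lhs => rw [hsum]
    simp [toReal_apply, realForm_tmul]
  have hmod : ∀ i, v i ≡ LinearMap.BilinForm.toMatrix b Q i i [ZMOD 2] := by
    intro i
    have h := hξ.2 (b i)
    rw [← hv i] at h
    obtain ⟨z, hz⟩ := AddCommGroup.modEq_iff_zsmul.mp h
    refine Int.modEq_iff_dvd.mpr ⟨z, ?_⟩
    rw [LinearMap.BilinForm.toMatrix_apply]
    rw [zsmul_eq_mul, mul_comm] at hz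
    exact_mod_cast hz.symm
  have hξξ : realForm Q ξ ξ = (fun i => (v i : ℝ)) ⬝ᵥ c := by
    conv_lhs => enter [2]; rw [hsum]
    simp [hv, dotProduct, mul_comm]
  rw [hξξ]
  refine Matrix.exists_intCast_eq_det_mul _ ?_ v hmod c ?_
  · ext i j
    simp [LinearMap.BilinForm.toMatrix_apply, hsymm.eq]
  · ext i
    rw [hv, hQξ]
    simp only [Matrix.mulVec, dotProduct, Matrix.map_apply, LinearMap.BilinForm.toMatrix_apply]
    exact Finset.sum_congr rfl fun j _ => by rw [hsymm.eq, mul_comm]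

end IntLattice

/-- Modulo 4 the index `k` enters only through the sign `(-1)^k`, which makes the final congruences
decidable by enumeration. -/
theorem ZMod.two_mul_eq_one_sub_neg_one_pow (k : ℕ) :
    (2 * k : ZMod 4) = 1 - (-1) ^ k ∧ ((-1 : ZMod 4) ^ k = 1 ∨ (-1 : ZMod 4) ^ k = -1) := by
  have h4 : (4 : ZMod 4) = 0 := by decide
  obtain ⟨j, rfl | rfl⟩ := Nat.even_or_odd' k
  · rw [pow_mul, neg_one_sq, one_pow]
    push_cast
    exact ⟨by linear_combination j * h4, Or.inl rfl⟩
  · rw [pow_succ, pow_mul, neg_one_sq, one_pow]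
    push_cast
    exact ⟨by linear_combination j * h4, Or.inr (by ring)⟩

theorem mainTheorem6 {L : Type*} [AddCommGroup L] [Module.Free ℤ L] [Module.Finite ℤ L]
    (Q : LinearMap.BilinForm ℤ L) (hsymm : Q.IsSymm) (hnd : Q.Nondegenerate)
    (δ : ℕ) (hδ : (IntLattice.latticeDet Q).natAbs = δ)
    (ξ : TensorProduct ℤ ℝ L) (hξ : IntLattice.IsCharacteristicCovector Q ξ) :
    (Odd δ → IntLattice.realForm Q ξ ξ ≡
      (IntLattice.signature Q : ℝ) - 1 + 1 / (δ : ℝ) [PMOD (4 / (δ : ℝ))]) ∧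
    (Even δ → IntLattice.realForm Q ξ ξ ≡
      (IntLattice.signature Q : ℝ) - 1 [PMOD (4 / (δ : ℝ))]) := by
  classical
  let b := Module.Free.chooseBasis ℤ L
  set G := LinearMap.BilinForm.toMatrix b Q with hG
  have hD : IntLattice.latticeDet Q = G.det := IntLattice.latticeDet_eq Q b
  have hD0 : G.det ≠ 0 := (LinearMap.BilinForm.nondegenerate_iff_det_ne_zero b).mp hnd
  obtain ⟨x, hx, hx4⟩ := hξ.exists_intCast_eq_det_mul hsymm b
  have hmat := IntLattice.toMatrix_realForm Q b
  have hdetR : (LinearMap.BilinForm.toMatrix (b.baseChange ℝ) (IntLattice.realForm Q)).det =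
      (G.det : ℝ) := by
    rw [hmat]
    exact ((Int.castRingHom ℝ).map_det G).symm
  have hRsymm : (IntLattice.realForm Q).IsSymm := 
    ⟨(LinearMap.BilinForm.IsSymm.baseChange ℝ ⟨hsymm.eq⟩).eq⟩
  obtain ⟨hcard, hsign⟩ := LinearMap.BilinForm.sigPos_add_sigNeg_and_sign_det (b.baseChange ℝ)
    (IntLattice.realForm Q) hRsymm (by rw [hdetR]; exact_mod_cast hD0)
  rw [hdetR] at hsign
  generalize hk : sigNeg (IntLattice.realForm Q).toQuadraticMap = k at hcard hsign
  have hσ : IntLattice.signature Q =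
      (Fintype.card (Module.Free.ChooseBasisIndex ℤ L) : ℤ) - 2 * k := by
    rw [IntLattice.signature, ← hcard, hk]
    push_cast
    ring
  rw [← hG] at hx hx4
  have hδD : (δ : ℤ) = (-1) ^ k * G.det := by
    have hpos : 0 < (-1) ^ k * G.det := by
      exact_mod_cast hsign
    rw [← hδ, hD, Int.natCast_natAbs, ← abs_of_pos hpos, abs_mul, abs_neg_one_pow, one_mul]
  generalize G.det = D at *
  generalize IntLattice.realForm Q ξ ξ = y at *
  generalize IntLattice.signature Q = σ at *
  generalize Fintype.card (Module.Free.ChooseBasisIndex ℤ L) = n at *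
  have hδ0 : (δ : ℝ) ≠ 0 := by
    intro h
    have h0 : (δ : ℤ) = 0 := by exact_mod_cast h
    rw [h0] at hδD
    rcases mul_eq_zero.mp hδD.symm with h | h
    · exact pow_ne_zero k (by norm_num) h
    · exact hD0 h
  have hδR : (δ : ℝ) = (-1) ^ k * D := by exact_mod_cast hδD
  -- Here `r` is 1 for odd `δ` and 0 for even `δ`. Since `δ * y = (-1)^k * x`, the claim multiplied
  -- by `δ` is an integer congruence modulo 4.
  have hmod (r : ℤ) (h : (4 : ℤ) ∣ δ * (σ - 1) + r - (-1) ^ k * x) :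
      y ≡ (σ : ℝ) - 1 + r / δ [PMOD (4 / (δ : ℝ))] := by
    obtain ⟨z, hz⟩ := h
    refine AddCommGroup.modEq_iff_zsmul.mpr ⟨z, ?_⟩
    have hzR : (δ : ℝ) * (σ - 1) + r - (-1) ^ k * x = 4 * z := by exact_mod_cast hz
    rw [zsmul_eq_mul]
    field_simp
    rw [hx, ← mul_assoc, ← hδR] at hzR
    linear_combination -hzR
  have hzmod (r : ℤ)
      (h : ((-1 : ZMod 4) ^ k * D * (n - 2 * k - 1) + r - (-1) ^ k * (D * (n - 1) + D ^ 2)) = 0) :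
      (4 : ℤ) ∣ δ * (σ - 1) + r - (-1) ^ k * x := by
    refine (ZMod.intCast_zmod_eq_zero_iff_dvd _ 4).mp ?_
    rw [hδD, hσ]
    push_cast
    rw [hx4]
    exact h
  have hpar : Even (δ : ℤ) ↔ Even D := by
    rw [hδD, Int.even_mul]
    have : ¬ Even ((-1 : ℤ) ^ k) := Int.not_even_iff_odd.mpr (Odd.pow (by decide))
    tauto
  obtain ⟨hk2, ht⟩ := ZMod.two_mul_eq_one_sub_neg_one_pow k
  constructor
  · intro hodd
    have hDodd : Odd D := by
      rw [← Int.not_even_iff_odd, ← hpar, Int.not_even_iff_odd]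
      exact_mod_cast hodd
    have h := hmod 1 (hzmod 1 (by
      obtain ⟨j, rfl⟩ := hDodd
      rw [hk2]
      push_cast
      generalize (j : ZMod 4) = j at *
      generalize (n : ZMod 4) = n at *
      generalize (-1 : ZMod 4) ^ k = t at *
      clear * - ht
      revert t n j
      decide))
    simpa using h
  · intro heven
    have hDeven : Even D := hpar.mp (by exact_mod_cast heven)
    have h := hmod 0 (hzmod 0 (by
      obtain ⟨j, rfl⟩ := hDeven
      rw [hk2]
      push_cast
      generalize (j : ZMod 4) = j at *
      generalize (n : ZMod 4) = n at *
      generalize (-1 : ZMod 4) ^ k = t at *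
      clear * - ht
      revert t n j
      decide))
    simpa using h
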